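/- In the game of Cops and Robbers on a connected graph $G$, the cop player first places $k$ cops on vertices of $G$, and then the robber player places the robber on a vertex. The players then alternate, the cops moving first: on the cops' turn each cop passes or moves to an adjacent vertex, and on the robber's turn the robber passes or moves to an adjacent vertex; both players see everything. The cops win if after finitely many moves a cop occupies the vertex of the robber. The cop number $c(G)$ is the least $k$ such that $k$ cops can win regardless of how the robber plays. **Theorem.** Let $G$ be a connected graph whose longest path is of length $p$, where the length of a path is its number of vertices (i.e. $G$ contains a path on $p$ vertices as a subgraph, not necessarily induced, and no path on more than $p$ vertices). Then $$c(G) \le \left\lceil \frac{2p}{3} \right\rceil + 3 .$$ -/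

import Mathlib

namespace SimpleGraph

/-- One move of a single player token (a cop or the robber): pass, or go to an adjacent vertex. -/
def TokenMove {V : Type*} (G : SimpleGraph V) (u v : V) : Prop :=
  v = u ∨ G.Adj u v

/-- A strategy for `k` cops in the game of Cops and Robbers on `G` (perfect information).
`pos h` is the position of the cops after they have reacted to the robber positions listed in `h`
(most recent first); `pos []` is the initial placement, chosen before the robber is placed.
In each turn every cop passes or moves to an adjacent vertex. -/
structure CopStrategy {V : Type*} (G : SimpleGraph V) (k : ℕ) where
  pos : List V → Fin k → V
  legal : ∀ (h : List V) (r : V) (i : Fin k), G.TokenMove (pos h i) (pos (r :: h) i)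

/-- An infinite sequence of robber positions obeying the rules: `ρ 0` is the arbitrary initial
placement, `ρ n` is the position of the robber when the cops make their `(n + 1)`-st move. -/
def IsRobberPlay {V : Type*} (G : SimpleGraph V) (ρ : ℕ → V) : Prop :=
  ∀ n, G.TokenMove (ρ n) (ρ (n + 1))

/-- The list `[ρ (n - 1), …, ρ 0]` of the first `n` robber positions, most recent first. -/
def robberHistory {V : Type*} (ρ : ℕ → V) : ℕ → List V
  | 0 => []
  | n + 1 => ρ n :: robberHistory ρ n

/-- The strategy wins: however the robber plays, after finitely many moves some cop moves onto
(or passes on) the vertex occupied by the robber. -/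
def CopStrategy.IsWinning {V : Type*} {G : SimpleGraph V} {k : ℕ} (S : G.CopStrategy k) : Prop :=
  ∀ ρ : ℕ → V, G.IsRobberPlay ρ →
    ∃ (n : ℕ) (i : Fin k), S.pos (robberHistory ρ (n + 1)) i = ρ n

/-- `k` cops have a winning strategy on `G`. -/
def CopsWin {V : Type*} (G : SimpleGraph V) (k : ℕ) : Prop :=
  ∃ S : G.CopStrategy k, S.IsWinning

/-- The cop number of `G`: the least `k` such that `k` cops have a winning strategy
(`⊤` if no finite number of cops suffices). -/
noncomputable def copNumber {V : Type*} (G : SimpleGraph V) : ℕ∞ :=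
  ⨅ (k : ℕ) (_ : G.CopsWin k), (k : ℕ∞)

/-- A longest path of `G` (as a not necessarily induced subgraph) has exactly `p` vertices. -/
def LongestPathHasOrder {V : Type*} (G : SimpleGraph V) (p : ℕ) : Prop :=
  (∃ (u v : V) (w : G.Walk u v), w.IsPath ∧ w.support.length = p) ∧
    ∀ (u v : V) (w : G.Walk u v), w.IsPath → w.support.length ≤ p

end SimpleGraph

namespace SimpleGraph

variable {V : Type*} {G : SimpleGraph V} {k : ℕ}

/-! In fact any `k > p / 2` cops win. The cops hold a path on `2 * s - 1` vertices dominated by `s`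
of them, whose head has a neighbour `a` in the robber's region. A spare cop walks to `a`; meanwhile
the robber cannot enter the path without being caught. Unless the robber is then within reach of
`a`, let `b` be the next vertex from `a` towards the robber: the cop on `a` dominates both `a` and
`b`, so each new cop lengthens the path by two vertices. No path exceeds `p` vertices, so this ends
in capture (`exists_copsWinIn_of_dominated_path`). -/

/-- The cops, at positions `c` and about to move, can capture the robber at `r` within `n` turns. -/
def CopsWinIn (G : SimpleGraph V) : ℕ → (Fin k → V) → V → Prop
  | 0, _, _ => False
  | n + 1, c, r => ∃ c' : Fin k → V, (∀ i, G.TokenMove (c i) (c' i)) ∧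
      ((∃ i, c' i = r) ∨ ∀ r', G.TokenMove r r' → CopsWinIn G n c' r')

theorem CopsWinIn.succ {n : ℕ} {c : Fin k → V} {r : V} (h : G.CopsWinIn n c r) :
    G.CopsWinIn (n + 1) c r := by
  induction n generalizing c r with
  | zero => exact h.elim
  | succ n ih =>
    obtain ⟨c', hc, h⟩ := h
    exact ⟨c', hc, h.imp_right fun h r' hr => ih (h r' hr)⟩

theorem CopsWinIn.mono {n m : ℕ} (hnm : n ≤ m) {c : Fin k → V} {r : V}
    (h : G.CopsWinIn n c r) : G.CopsWinIn m c r := by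
  induction hnm with
  | refl => exact h
  | step _ ih => exact ih.succ

theorem copsWinIn_of_tokenMove (n : ℕ) {c : Fin k → V} {r : V} {j : Fin k}
    (h : G.TokenMove (c j) r) : G.CopsWinIn (n + 1) c r := by
  classical
  refine ⟨Function.update c j r, fun i => ?_, Or.inl ⟨j, by simp⟩⟩
  rcases eq_or_ne i j with rfl | hij
  · simpa using h
  · exact Or.inl (by simp [hij])

/-- Minimising the number of remaining turns makes one move serve every bound `n`, so the strategy
can be positional. -/
theorem exists_best_copMove (c : Fin k → V) (r : V) :
    ∃ c' : Fin k → V, (∀ i, G.TokenMove (c i) (c' i)) ∧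
      ∀ n, G.CopsWinIn n c r →
        (∃ i, c' i = r) ∨ ∃ m < n, ∀ r', G.TokenMove r r' → G.CopsWinIn m c' r' := by
  classical
  by_cases h : ∃ n, G.CopsWinIn n c r
  · have hs := Nat.find_spec h
    have hmin := fun n hn => Nat.find_min' h (m := n) hn
    generalize Nat.find h = N at hs hmin
    cases N with
    | zero => exact hs.elim
    | succ N =>
      obtain ⟨c', hc, hw⟩ := hs
      exact ⟨c', hc, fun n hn => hw.imp_right fun hw => ⟨N, hmin n hn, hw⟩⟩
  · exact ⟨c, fun _ => Or.inl rfl, fun n hn => (h ⟨n, hn⟩).elim⟩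

theorem copsWin_of_copsWinIn (c₀ : Fin k → V) (h : ∀ r, ∃ n, G.CopsWinIn n c₀ r) :
    G.CopsWin k := by
  choose next hlegal hnext using exists_best_copMove (G := G) (k := k)
  let pos : List V → Fin k → V := fun l => List.rec c₀ (fun r _ c => next c r) l
  refine ⟨⟨pos, fun h r i => hlegal (pos h) r i⟩, fun ρ hρ => ?_⟩
  have key : ∀ n t, G.CopsWinIn n (pos (robberHistory ρ t)) (ρ t) →
      ∃ (t' : ℕ) (i : Fin k), pos (robberHistory ρ (t' + 1)) i = ρ t' := by
    intro n
    induction n using Nat.strong_induction_on with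
    | _ n ih =>
      intro t ht
      rcases hnext _ _ n ht with ⟨i, hi⟩ | ⟨m, hm, hw⟩
      · exact ⟨t, i, hi⟩
      · exact ih m hm (t + 1) (hw _ (hρ t))
  obtain ⟨n, hn⟩ := h (ρ 0)
  exact key n 0 hn

/-- A cop may walk along `w` while the others keep the robber inside the region `R`. -/
theorem copsWinIn_of_walk {n : ℕ} {R : V → Prop} {i : Fin k} {u x : V} (w : G.Walk u x)
    (c : Fin k → V) (hu : c i = u)
    (hR : ∀ r r', R r → G.TokenMove r r' → R r' ∨ ∃ j ≠ i, G.TokenMove (c j) r')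
    (hwin : ∀ r, R r → G.CopsWinIn (n + 1) (Function.update c i x) r) (r : V) (hr : R r) :
    G.CopsWinIn (n + 1 + w.length) c r := by
  induction w generalizing c r with
  | nil => simpa [← hu] using hwin r hr
  | @cons u v x huv w ih =>
    refine ⟨Function.update c i v, fun j => ?_, Or.inr fun r' hr' => ?_⟩
    · rcases eq_or_ne j i with rfl | hj
      · exact Or.inr (by simpa [hu] using huv)
      · exact Or.inl (by simp [hj])
    · rcases hR r r' hr hr' with h | ⟨j, hj, h⟩
      · refine ih (Function.update c i v) (by simp) (fun a b ha hab => ?_) (by simpa using hwin)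
          r' h
        refine (hR a b ha hab).imp_right ?_
        rintro ⟨j, hj, h⟩
        exact ⟨j, hj, by simpa [hj] using h⟩
      -- The `+ 1` in the turn budget pays for this capture, even after the last step of the walk.
      · have : G.CopsWinIn (n + w.length + 1) (Function.update c i v) r' :=
          copsWinIn_of_tokenMove _ (j := j) (by simpa [hj] using h)
        exact this.mono (by change _ ≤ n + 1 + w.length; omega)

/-- `y` can be reached from `x` without entering `S`. -/
def ReachAvoiding (G : SimpleGraph V) (S : Set V) : V → V → Prop :=
  Relation.ReflTransGen fun x y => G.Adj x y ∧ y ∉ S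

theorem ReachAvoiding.notMem {S : Set V} {x y : V} (h : G.ReachAvoiding S x y) (hx : x ∉ S) :
    y ∉ S := by
  rcases Relation.ReflTransGen.cases_tail h with rfl | ⟨_, _, h⟩
  exacts [hx, h.2]

/-- Cut the route at its first visit to `y`; `z` is the vertex just before. -/
theorem ReachAvoiding.exists_adj {S : Set V} {x y : V} (h : G.ReachAvoiding S x y)
    (hxy : x ≠ y) : ∃ z, G.ReachAvoiding (insert y S) x z ∧ G.Adj y z := by
  induction h using Relation.ReflTransGen.head_induction_on with
  | refl => exact (hxy rfl).elim
  | @head x x' hx _ ih =>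
    by_cases hx' : x' = y
    · subst hx'
      exact ⟨x, .refl, hx.1.symm⟩
    · obtain ⟨z, hz, hyz⟩ := ih hx'
      exact ⟨z, .head ⟨hx.1, by simp [hx', hx.2]⟩ hz, hyz⟩

theorem Connected.reachAvoiding_empty (hG : G.Connected) (x y : V) : G.ReachAvoiding ∅ x y := by
  obtain ⟨w⟩ := hG.preconnected x y
  induction w with
  | nil => exact .refl
  | cons h _ ih => exact .head ⟨h, by simp⟩ ih

/-- If the first `s` cops dominate a path and the head of the path has a neighbour in the region
of the robber, then the cops can win in a bounded number of turns. -/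
theorem exists_copsWinIn_of_dominated_path (hG : G.Connected) {p : ℕ}
    (hp : ∀ (u v : V) (w : G.Walk u v), w.IsPath → w.support.length ≤ p) (hk : p < 2 * k) (d : ℕ) :
    ∃ n, ∀ (s : ℕ) (v u : V) (w : G.Walk v u) (c : Fin k → V) (r : V), w.IsPath →
      w.support.length + 1 = 2 * s → p ≤ w.support.length + d →
      (∀ z ∈ w.support, ∃ j : Fin k, j.val < s ∧ G.TokenMove (c j) z) → r ∉ w.support →
      (∃ a, G.ReachAvoiding {z | z ∈ w.support} r a ∧ G.Adj v a) → G.CopsWinIn n c r := by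
  induction d with
  | zero =>
    refine ⟨0, fun s v u w c r hw _ hd _ hr ⟨a, ha, hva⟩ => ?_⟩
    have := hp _ _ (w.cons hva.symm) (hw.cons (ha.notMem hr))
    simp only [Walk.support_cons, List.length_cons] at this
    omega
  | succ d ih =>
    obtain ⟨n, hn⟩ := ih
    -- `V` may be infinite, so the bound must not depend on the position; `p` bounds the new cop's
    -- walk.
    refine ⟨n + 1 + p, fun s v u w c r hw hs hd hc hr ⟨a, ha, hva⟩ => ?_⟩
    have haw : a ∉ w.support := ha.notMem hr
    have hlen := hp _ _ (w.cons hva.symm) (hw.cons haw)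
    simp only [Walk.support_cons, List.length_cons] at hlen
    -- The path together with `a` has `2 * s ≤ p < 2 * k` vertices, so a spare cop exists.
    have hsk : s < k := by omega
    obtain ⟨q, hq⟩ := (hG.preconnected (c ⟨s, hsk⟩) a).exists_isPath
    have hqp : q.length ≤ p := by
      have := hp _ _ q hq
      simp only [Walk.length_support] at this
      omega
    refine (copsWinIn_of_walk (n := n) (i := ⟨s, hsk⟩)
      (R := fun r => r ∉ w.support ∧ G.ReachAvoiding {z | z ∈ w.support} r a) q c rfl ?_ ?_ r
      ⟨hr, ha⟩).mono (by omega)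
    · rintro r r' ⟨hr, hra⟩ hrr'
      by_cases hr' : r' ∈ w.support
      · obtain ⟨j, hj, hjr⟩ := hc r' hr'
        exact Or.inr ⟨j, fun h => by simp [h] at hj, hjr⟩
      · rcases hrr' with rfl | hrr'
        · exact Or.inl ⟨hr, hra⟩
        · exact Or.inl ⟨hr', .head ⟨hrr'.symm, hr⟩ hra⟩
    · rintro r ⟨hr, hra⟩
      -- If no capture is possible from `a`, the robber is on neither `a` nor its neighbour `b`,
      -- hence off the extended path.
      by_cases hcap : G.TokenMove a r
      · exact copsWinIn_of_tokenMove n (j := ⟨s, hsk⟩) (by simpa using hcap)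
      · have hrne : r ≠ a := fun h => hcap (Or.inl h)
        obtain ⟨b, hb, hab⟩ := hra.exists_adj hrne
        have hrb : r ≠ b := fun h => hcap (Or.inr (h ▸ hab))
        obtain ⟨b', hb', hbb'⟩ := hb.exists_adj hrb
        have hb_mem := hb.notMem (by simp [hrne, hr])
        simp only [Set.mem_insert_iff, Set.mem_ofPred_eq, not_or] at hb_mem
        refine (hn (s + 1) b u ((w.cons hva.symm).cons hab.symm) _ r
          ((hw.cons haw).cons (by simpa using hb_mem)) ?_ ?_ ?_ ?_
          ⟨b', ?_, hbb'⟩).succ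
        · simp only [Walk.support_cons, List.length_cons]
          omega
        · simp only [Walk.support_cons, List.length_cons]
          omega
        · intro z hz
          simp only [Walk.support_cons, List.mem_cons] at hz
          rcases hz with rfl | rfl | hz
          · exact ⟨⟨s, hsk⟩, by simp, Or.inr (by simpa using hab)⟩
          · exact ⟨⟨s, hsk⟩, by simp, Or.inl (by simp)⟩
          · obtain ⟨j, hj, hjz⟩ := hc z hz
            have hjs : j ≠ ⟨s, hsk⟩ := fun h => by simp [h] at hj
            exact ⟨j, by omega, by simpa [hjs] using hjz⟩
        · simp [hrne, hrb, hr]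
        · convert hb' using 1
          ext z
          simp

/-- More than `p / 2` cops win on a connected graph all of whose paths have at most `p` vertices. -/
theorem Connected.copsWin_of_support_length_le (hG : G.Connected) {p : ℕ}
    (hp : ∀ (u v : V) (w : G.Walk u v), w.IsPath → w.support.length ≤ p) (hk : p < 2 * k) :
    G.CopsWin k := by
  obtain ⟨x⟩ := hG.nonempty
  have hk0 : 0 < k := by omega
  obtain ⟨n, hn⟩ := exists_copsWinIn_of_dominated_path hG hp hk p
  refine copsWin_of_copsWinIn (fun _ => x) fun r => ?_
  by_cases hr : r = x
  · exact ⟨1, copsWinIn_of_tokenMove 0 (j := ⟨0, hk0⟩) (Or.inl hr)⟩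
  · obtain ⟨z, hz, hxz⟩ := (hG.reachAvoiding_empty r x).exists_adj hr
    refine ⟨n, hn 1 x x .nil _ r (by simp) (by simp) (by simp) ?_ (by simpa using hr)
      ⟨z, by simpa using hz, hxz⟩⟩
    intro y hy
    exact ⟨⟨0, hk0⟩, by simp, Or.inl (by simpa using hy)⟩

end SimpleGraph

theorem theorem3 {V : Type*} (G : SimpleGraph V) (hG : G.Connected) (p : ℕ)
    (hp : G.LongestPathHasOrder p) :
    G.copNumber ≤ ((⌈(2 * (p : ℚ)) / 3⌉₊ + 3 : ℕ) : ℕ∞) := by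
  -- Only `p < 2 * (⌈2p/3⌉ + 3)` is needed, which leaves ample slack.
  refine iInf₂_le _ (hG.copsWin_of_support_length_le hp.2 ?_)
  have h := Nat.le_ceil ((2 * (p : ℚ)) / 3)
  have : (p : ℚ) < 2 * (⌈(2 * (p : ℚ)) / 3⌉₊ + 3) := by
    have : (0 : ℚ) ≤ p := p.cast_nonneg
    linarith
  exact_mod_cast this
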